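/- Let $n$ be a positive integer and $\alpha>0$. On $\mathbb C^n$ put $z\cdot\overline w=\sum_{j=1}^n z_j\overline{w_j}$, $|z|=\sqrt{z\cdot\overline z}$, and let $d\lambda_\alpha(z)=(\alpha/\pi)^n e^{-\alpha|z|^2}\,dv(z)$, where $dv$ is Lebesgue measure. The Fock space $F^2_\alpha$ is the space of entire functions in $L^2(\mathbb C^n,d\lambda_\alpha)$, with the $L^2$ norm; its reproducing kernel is $K(z,w)=e^{\alpha z\cdot\overline w}$. For a symbol $\varphi$ with $\varphi\in F^2_\alpha$ or $\overline\varphi\in F^2_\alpha$, the Toeplitz operator $T_\varphi$ is defined on finite linear combinations $h$ of the kernel functions $K(\cdot,w)$, $w\in\mathbb C^n$, by $$T_\varphi h(z)=\int_{\mathbb C^n}\varphi(w)h(w)e^{\alpha z\cdot\overline w}\,d\lambda_\alpha(w),\qquad z\in\mathbb C^n .$$ For $f,g\in F^2_\alpha$ the product $T_fT_{\overline g}$ is thereby defined on finite linear combinations of kernel functions ($T_{\overline g}$ maps these to functions of the same kind), and it is called bounded on $F^2_\alpha$ if it extends to a bounded linear operator on $F^2_\alpha$. Theorem. Let $f,g\in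 F^2_\alpha$. Then $T_fT_{\overline g}$ is bounded on $F^2_\alpha$ if and only if one of the following holds: (a) at least one of $f$ and $g$ is identically zero; (b) there are a complex polynomial $q$ on $\mathbb C^n$ of degree at most $1$ and a nonzero complex constant $c$ such that $f=e^{q}$ and $g=c\,e^{-q}$. Moreover, whenever a bounded linear operator $T$ on $F^2_\alpha$ extends $T_fT_{\overline g}$ and $T\neq0$, there are a nonzero complex constant $c'$ and a point $a\in\mathbb C^n$ such that $T=c'\,U_a$, where $U_a$ is the weighted translation $$U_ah(z)=h(z-a)\,e^{\alpha z\cdot\overline a-\frac{\alpha}{2}|a|^2},$$ which is a unitary operator of $F^2_\alpha$ onto itself. -/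

import Mathlib

open MeasureTheory

noncomputable section

/-- The Gaussian measure `dλ_α(z) = (α/π)^n exp(-α|z|²) dv(z)` on `ℂⁿ`, where `dv` is Lebesgue
measure and `|z|² = ∑ |z_j|²` is the Euclidean norm squared. -/
def fockMeasure (n : ℕ) (α : ℝ) : Measure (Fin n → ℂ) :=
  (volume : Measure (Fin n → ℂ)).withDensity fun z =>
    ENNReal.ofReal ((α / Real.pi) ^ n * Real.exp (-α * ∑ j, ‖z j‖ ^ 2))

/-- The Fock space `F²_α(ℂⁿ)`: the subspace of `L²(ℂⁿ, dλ_α)` of the classes of entire functions,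
with the norm and the inner product of `L²`. -/
def FockSpace (n : ℕ) (α : ℝ) : Submodule ℂ (Lp ℂ 2 (fockMeasure n α)) where
  carrier := {F | ∃ f : (Fin n → ℂ) → ℂ, Differentiable ℂ f ∧ F =ᵐ[fockMeasure n α] f}
  zero_mem' := ⟨0, differentiable_const 0, Lp.coeFn_zero ℂ 2 _⟩
  add_mem' := by
    rintro F G ⟨f, hf, hFf⟩ ⟨g, hg, hGg⟩
    exact ⟨f + g, hf.add hg, (Lp.coeFn_add F G).trans (hFf.add hGg)⟩
  smul_mem' := by
    rintro c F ⟨f, hf, hFf⟩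
    exact ⟨c • f, hf.const_smul c, (Lp.coeFn_smul c F).trans (hFf.const_smul c)⟩

/-- The function `f` on `ℂⁿ` belongs to `F²_α`: it is entire and square integrable for `dλ_α`. -/
def MemFock {n : ℕ} (α : ℝ) (f : (Fin n → ℂ) → ℂ) : Prop :=
  Differentiable ℂ f ∧ MemLp f 2 (fockMeasure n α)

/-- The reproducing kernel `K(z, w) = exp(α z · w̄)`. -/
def fockKernel {n : ℕ} (α : ℝ) (z w : Fin n → ℂ) : ℂ :=
  Complex.exp (α * ∑ j, z j * starRingEnd ℂ (w j))

/-- The normalized reproducing kernel `k_a(z) = K(z, a) / √K(a, a) = exp(α z · ā - α|a|²/2)`. -/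
def normalizedKernel {n : ℕ} (α : ℝ) (a z : Fin n → ℂ) : ℂ :=
  Complex.exp (α * ∑ j, z j * starRingEnd ℂ (a j) - ((α / 2 * ∑ j, ‖a j‖ ^ 2 : ℝ) : ℂ))

/-- The space of finite linear combinations of the kernel functions `K(·, w)`, `w ∈ ℂⁿ`. -/
def kernelSpan (n : ℕ) (α : ℝ) : Submodule ℂ ((Fin n → ℂ) → ℂ) :=
  Submodule.span ℂ (Set.range fun (w z : Fin n → ℂ) => fockKernel α z w)

/-- The Toeplitz operator with symbol `φ`, as an integral operator:
`T_φ h (z) = ∫ φ(w) h(w) exp(α z · w̄) dλ_α(w)`. -/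
def toeplitz {n : ℕ} (α : ℝ) (φ h : (Fin n → ℂ) → ℂ) : (Fin n → ℂ) → ℂ :=
  fun z => ∫ w, φ w * h w * fockKernel α z w ∂(fockMeasure n α)

/-- The Toeplitz product `T_f T_ḡ`, applied to the function `h`. -/
def toeplitzProduct {n : ℕ} (α : ℝ) (f g h : (Fin n → ℂ) → ℂ) : (Fin n → ℂ) → ℂ :=
  toeplitz α f (toeplitz α (fun w => starRingEnd ℂ (g w)) h)

/-- The bounded operator `T` on `F²_α` extends `T_f T_ḡ` from the finite linear combinations of
kernel functions: each such combination `h` has a class `H` in `F²_α`, and `T H` is the class of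
`T_f T_ḡ h`. -/
def ExtendsToeplitzProduct {n : ℕ} (α : ℝ) (f g : (Fin n → ℂ) → ℂ)
    (T : FockSpace n α →L[ℂ] FockSpace n α) : Prop :=
  ∀ h ∈ kernelSpan n α, ∃ H : FockSpace n α,
    (H : Lp ℂ 2 (fockMeasure n α)) =ᵐ[fockMeasure n α] h ∧
    (T H : Lp ℂ 2 (fockMeasure n α)) =ᵐ[fockMeasure n α] toeplitzProduct α f g h

/-- `T_f T_ḡ` is bounded on `F²_α`: it extends from the finite linear combinations of kernel
functions to a bounded operator on `F²_α`. -/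
def BoundedToeplitzProduct {n : ℕ} (α : ℝ) (f g : (Fin n → ℂ) → ℂ) : Prop :=
  ∃ T : FockSpace n α →L[ℂ] FockSpace n α, ExtendsToeplitzProduct α f g T

/-- The unitary operator `U` on `F²_α` is the weighted translation
`U_a h (z) = h(z - a) k_a(z)`. -/
def IsWeightedTranslation {n : ℕ} (α : ℝ) (a : Fin n → ℂ)
    (U : FockSpace n α ≃ₗᵢ[ℂ] FockSpace n α) : Prop :=
  ∀ H : FockSpace n α, (U H : Lp ℂ 2 (fockMeasure n α)) =ᵐ[fockMeasure n α]
    fun z => (H : Lp ℂ 2 (fockMeasure n α)) (z - a) * normalizedKernel α a z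

end

/-! Write `K_a` for the kernel function at `a`. By the reproducing property, `T_f T_ḡ K_a = conj (g
a) • f K_a`. If a bounded `T` extends the product, point evaluation at `z + u` applied to `T K_z`
bounds `|f(z+u) g(z)| |K(z+u,z)|` by `‖T‖ exp(α|z+u|²/2) exp(α|z|²/2)`. Since `|z+u|² + |z|² - 2 Re
(z+u)·z̄ = |u|²`, the dependence on `z` cancels and `|f(z+u) g(z)| ≤ ‖T‖ exp(α|u|²/2)`
(`ExtendsToeplitzProduct.norm_mul_le`). By Liouville in `z`, `f(z+u) g(z) = f(u) g(0)`
(`ExtendsToeplitzProduct.apply_add_mul`). Unless `f` or `g` vanishes identically, `f / f(0)`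
therefore turns sums into products, so it is the exponential of a linear form
(`exists_clm_eq_exp_of_map_add`).

Conversely, such an `f` is a multiple of some `K_a`, and on every kernel function the product acts
as a constant times the unitary `U_a` (`exists_extendsToeplitzProduct_smul`). Kernel functions span
a dense subspace, so the extension is unique and equals that multiple of `U_a`. -/

/-! ### The Gaussian measure and its mean value property. -/

/-- The density of `fockMeasure n α` with respect to Lebesgue measure. -/
noncomputable def fockDensity (n : ℕ) (α : ℝ) (z : Fin n → ℂ) : ℝ :=
  (α / Real.pi) ^ n * Real.exp (-α * ∑ j, ‖z j‖ ^ 2)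

theorem fockDensity_pos {α : ℝ} (hα : 0 < α) {n : ℕ} (z : Fin n → ℂ) : 0 < fockDensity n α z := by
  have := Real.pi_pos
  unfold fockDensity
  positivity

theorem measurable_ofReal_fockDensity (n : ℕ) (α : ℝ) :
    Measurable fun z => ENNReal.ofReal (fockDensity n α z) := by
  unfold fockDensity
  fun_prop

theorem fockMeasure_eq (n : ℕ) (α : ℝ) : fockMeasure n α =
    (volume : Measure (Fin n → ℂ)).withDensity fun z => ENNReal.ofReal (fockDensity n α z) := rfl

instance sFinite_fockMeasure (n : ℕ) (α : ℝ) : SFinite (fockMeasure n α) := by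
  unfold fockMeasure
  infer_instance

theorem ae_fockMeasure_iff {n : ℕ} {α : ℝ} (hα : 0 < α) {p : (Fin n → ℂ) → Prop} :
    (∀ᵐ z ∂fockMeasure n α, p z) ↔ ∀ᵐ z, p z := by
  rw [fockMeasure_eq, ae_withDensity_iff (measurable_ofReal_fockDensity n α)]
  simp [fockDensity_pos hα]

theorem integral_fockMeasure {n : ℕ} {α : ℝ} (hα : 0 < α) (F : (Fin n → ℂ) → ℂ) :
    ∫ z, F z ∂fockMeasure n α = ∫ z, fockDensity n α z • F z := by
  rw [fockMeasure_eq, integral_withDensity_eq_integral_toReal_smul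
    (measurable_ofReal_fockDensity n α) (by simp)]
  simp [ENNReal.toReal_ofReal (fockDensity_pos hα _).le]

theorem integrable_fockMeasure_iff {n : ℕ} {α : ℝ} (hα : 0 < α) {E : Type*}
    [NormedAddCommGroup E] [NormedSpace ℝ E] (F : (Fin n → ℂ) → E) :
    Integrable F (fockMeasure n α) ↔ Integrable fun z => fockDensity n α z • F z := by
  rw [fockMeasure_eq, integrable_withDensity_iff_integrable_smul'
    (measurable_ofReal_fockDensity n α) (by simp)]
  simp [ENNReal.toReal_ofReal (fockDensity_pos hα _).le]

theorem eq_of_ae_eq_fockMeasure {n : ℕ} {α : ℝ} (hα : 0 < α) {F G : (Fin n → ℂ) → ℂ}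
    (hF : Continuous F) (hG : Continuous G) (h : F =ᵐ[fockMeasure n α] G) : F = G :=
  (hF.ae_eq_iff_eq volume hG).1 ((ae_fockMeasure_iff hα).1 h)

theorem fockDensity_eq_prod {n : ℕ} {α : ℝ} (z : Fin n → ℂ) :
    fockDensity n α z = ∏ j, (α / Real.pi * Real.exp (-α * ‖z j‖ ^ 2)) := by
  simp [fockDensity, Finset.prod_mul_distrib, ← Real.exp_sum, Finset.mul_sum, div_pow]

theorem integral_fockDensity {n : ℕ} {α : ℝ} (hα : 0 < α) :
    ∫ z : Fin n → ℂ, fockDensity n α z = 1 := by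
  simp_rw [fockDensity_eq_prod]
  rw [integral_fintype_prod_volume_eq_prod
    fun (_ : Fin n) (z : ℂ) => α / Real.pi * Real.exp (-α * ‖z‖ ^ 2)]
  refine Finset.prod_eq_one fun j _ => ?_
  rw [integral_const_mul, GaussianFourier.integral_rexp_neg_mul_sq_norm hα]
  have := Real.pi_pos
  simp
  field_simp

theorem integral_const_fockMeasure {n : ℕ} {α : ℝ} (hα : 0 < α) (c : ℂ) :
    ∫ _, c ∂fockMeasure n α = c := by
  rw [integral_fockMeasure hα, integral_smul_const, integral_fockDensity hα, one_smul]

theorem measurePreserving_circle_smul {n : ℕ} {α : ℝ} (c : Circle) :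
    MeasurePreserving (fun z : Fin n → ℂ => (c : ℂ) • z) (fockMeasure n α) (fockMeasure n α) := by
  have hv : MeasurePreserving (fun z : Fin n → ℂ => (c : ℂ) • z) volume volume :=
    volume_preserving_pi fun _ => (rotation c).measurePreserving
  refine ⟨hv.measurable, ?_⟩
  ext s hs
  rw [Measure.map_apply hv.measurable hs, fockMeasure_eq, withDensity_apply _ hs,
    withDensity_apply _ (hv.measurable hs), ← hv.setLIntegral_comp_preimage hs
      (measurable_ofReal_fockDensity n α)]
  simp only [fockDensity, Pi.smul_apply, smul_eq_mul, norm_mul, Circle.norm_coe, one_mul]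

/-- The mean value property for the Gaussian measure. -/
theorem integral_eq_apply_zero {n : ℕ} {α : ℝ} (hα : 0 < α) {G : (Fin n → ℂ) → ℂ}
    (hG : Differentiable ℂ G) (hi : Integrable G (fockMeasure n α)) :
    ∫ z, G z ∂fockMeasure n α = G 0 := by
  have hπ := Real.pi_pos
  have hcm : ∀ θ : ℝ, circleMap 0 1 θ = (Circle.exp θ : ℂ) := fun θ => by simp [circleMap]
  have hpres : ∀ θ : ℝ, MeasurePreserving (fun z : Fin n → ℂ => circleMap 0 1 θ • z)
      (fockMeasure n α) (fockMeasure n α) := fun θ => by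
    simp_rw [hcm]; exact measurePreserving_circle_smul _
  have hcont : Continuous (Function.uncurry fun (θ : ℝ) (z : Fin n → ℂ) =>
      G (circleMap 0 1 θ • z)) :=
    hG.continuous.comp (((continuous_circleMap 0 1).comp continuous_fst).smul continuous_snd)
  have hemb : ∀ (θ : ℝ) {E : Type} [NormedAddCommGroup E] [NormedSpace ℝ E]
      (F : (Fin n → ℂ) → E), Continuous F →
      ∫ z, F (circleMap 0 1 θ • z) ∂fockMeasure n α = ∫ z, F z ∂fockMeasure n α := by
    intro θ E _ _ F hF
    conv_rhs => rw [← (hpres θ).map_eq]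
    rw [integral_map (hpres θ).aemeasurable]
    rw [(hpres θ).map_eq]
    exact hF.aestronglyMeasurable
  -- Rotation invariance makes the inner integral of the norm independent of `θ`, which justifies
  -- Fubini.
  have hint : Integrable (Function.uncurry fun (θ : ℝ) (z : Fin n → ℂ) =>
      G (circleMap 0 1 θ • z)) ((volume.restrict (Set.Ioc 0 (2 * Real.pi))).prod
        (fockMeasure n α)) := by
    rw [integrable_prod_iff hcont.aestronglyMeasurable]
    constructor
    · refine Filter.Eventually.of_forall fun θ => ?_
      exact ((hpres θ).integrable_comp hi.aestronglyMeasurable).2 hi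
    · have : (fun θ : ℝ => ∫ z, ‖Function.uncurry (fun (θ : ℝ) (z : Fin n → ℂ) =>
          G (circleMap 0 1 θ • z)) (θ, z)‖ ∂fockMeasure n α) =
          fun _ => ∫ z, ‖G z‖ ∂fockMeasure n α := by
        funext θ
        exact hemb θ (fun z => ‖G z‖) hG.continuous.norm
      rw [this]
      exact integrable_const _
  have hswap := integral_integral_swap hint
  -- One-variable mean value property on the complex line through `z`.
  have h1 : ∀ z, ∫ θ in Set.Ioc 0 (2 * Real.pi), G (circleMap 0 1 θ • z) =
      (2 * Real.pi : ℝ) • G 0 := by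
    intro z
    have hd : Differentiable ℂ fun t : ℂ => G (t • z) :=
      hG.comp (differentiable_id.smul_const z)
    have := (hd.diffContOnCl (s := Metric.ball 0 |1|)).circleAverage
    rw [Real.circleAverage_def, intervalIntegral.integral_of_le (by positivity),
      inv_smul_eq_iff₀ (by positivity)] at this
    simpa using this
  simp_rw [h1] at hswap
  rw [integral_const_fockMeasure hα] at hswap
  simp_rw [fun θ => hemb θ G hG.continuous] at hswap
  rw [integral_const] at hswap
  have hs : (volume.restrict (Set.Ioc 0 (2 * Real.pi))).real Set.univ = 2 * Real.pi := by
    simp [Measure.real, hπ.le]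
  rw [hs] at hswap
  exact smul_right_injective ℂ (r := 2 * Real.pi) (by positivity) hswap

/-! ### The reproducing kernel. -/

section kernel

variable {n : ℕ} {α : ℝ}

theorem conj_fockKernel (z w : Fin n → ℂ) :
    starRingEnd ℂ (fockKernel α z w) = fockKernel α w z := by
  simp [fockKernel, ← Complex.exp_conj, mul_comm]

theorem fockKernel_add_right (z a b : Fin n → ℂ) :
    fockKernel α z (a + b) = fockKernel α z a * fockKernel α z b := by
  simp [fockKernel, ← Complex.exp_add, mul_add, Finset.sum_add_distrib]

theorem fockKernel_add_left (a b w : Fin n → ℂ) :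
    fockKernel α (a + b) w = fockKernel α a w * fockKernel α b w := by
  simp [fockKernel, ← Complex.exp_add, mul_add, add_mul, Finset.sum_add_distrib]

theorem fockKernel_self (a : Fin n → ℂ) :
    fockKernel α a a = Real.exp (α * ∑ j, ‖a j‖ ^ 2) := by
  simp [fockKernel, Complex.mul_conj']

theorem norm_fockKernel (z w : Fin n → ℂ) :
    ‖fockKernel α z w‖ = Real.exp (α * ∑ j, (z j * starRingEnd ℂ (w j)).re) := by
  rw [fockKernel, Complex.norm_exp, Complex.re_ofReal_mul, Complex.re_sum]

theorem norm_fockKernel_comm (z w : Fin n → ℂ) : ‖fockKernel α z w‖ = ‖fockKernel α w z‖ := by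
  rw [← conj_fockKernel, RCLike.norm_conj]

theorem fockKernel_zero_right (z : Fin n → ℂ) : fockKernel α z 0 = 1 := by simp [fockKernel]

theorem fockKernel_zero_left (z : Fin n → ℂ) : fockKernel α 0 z = 1 := by simp [fockKernel]

theorem fockKernel_neg_left (z w : Fin n → ℂ) :
    fockKernel α (-z) w = (fockKernel α z w)⁻¹ := by
  simp [fockKernel, ← Complex.exp_neg]

theorem differentiable_fockKernel (a : Fin n → ℂ) :
    Differentiable ℂ fun z => fockKernel α z a := by
  unfold fockKernel
  fun_prop

theorem continuous_fockKernel_right (z : Fin n → ℂ) :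
    Continuous fun w => fockKernel α z w := by
  unfold fockKernel
  fun_prop

theorem memLp_fockKernel (hα : 0 < α) (a : Fin n → ℂ) :
    MemLp (fun z => fockKernel α z a) 2 (fockMeasure n α) := by
  rw [memLp_two_iff_integrable_sq_norm (differentiable_fockKernel a).continuous.aestronglyMeasurable,
    integrable_fockMeasure_iff hα]
  have h1 : ∀ j : Fin n, Integrable fun z : ℂ =>
      α / Real.pi * Real.exp (-α * ‖z‖ ^ 2 + 2 * α * (z * starRingEnd ℂ (a j)).re) := by
    intro j
    refine Integrable.const_mul ?_ _
    have := (GaussianFourier.integrable_cexp_neg_mul_sq_norm_add (V := ℂ) (b := (α : ℂ))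
      (by simpa using hα) (2 * α) (a j)).norm
    refine this.congr (Filter.Eventually.of_forall fun z => ?_)
    simp only [Complex.norm_exp]
    congr 1
    rw [Complex.inner]
    generalize (z * starRingEnd ℂ (a j)).re = r
    rw [← Complex.ofReal_re (-α * ‖z‖ ^ 2 + 2 * α * r)]
    push_cast
    rfl
  refine (Integrable.fintype_prod h1).congr (Filter.Eventually.of_forall fun z => ?_)
  simp only [fockDensity_eq_prod, norm_fockKernel, smul_eq_mul, Real.exp_add, ← mul_assoc,
    Finset.prod_mul_distrib]
  congr 1
  rw [← Real.exp_nat_mul, ← Real.exp_sum, Finset.mul_sum, Finset.mul_sum]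
  congr 1
  refine Finset.sum_congr rfl fun j _ => ?_
  push_cast; ring

theorem memFock_fockKernel (hα : 0 < α) (a : Fin n → ℂ) :
    MemFock α fun z => fockKernel α z a :=
  ⟨differentiable_fockKernel a, memLp_fockKernel hα a⟩

/-- The modulus of the product is that of `K(w, a + z)`, although the product is not holomorphic in
`w`. -/
theorem memLp_fockKernel_mul (hα : 0 < α) (a z : Fin n → ℂ) :
    MemLp (fun w => fockKernel α w a * fockKernel α z w) 2 (fockMeasure n α) := by
  refine (memLp_congr_norm (memLp_fockKernel hα (a + z)).aestronglyMeasurable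
    ((differentiable_fockKernel a).continuous.mul
      (continuous_fockKernel_right z)).aestronglyMeasurable
    (Filter.Eventually.of_forall fun w => ?_)).1 (memLp_fockKernel hα (a + z))
  rw [fockKernel_add_right, norm_mul, norm_fockKernel_comm w z, ← norm_mul]
  rfl

theorem integrable_mul_fockKernel_mul (hα : 0 < α) {φ : (Fin n → ℂ) → ℂ}
    (hφ : MemLp φ 2 (fockMeasure n α)) (a z : Fin n → ℂ) :
    Integrable (fun w => φ w * fockKernel α w a * fockKernel α z w) (fockMeasure n α) := by
  simp_rw [mul_assoc]
  exact hφ.integrable_mul (memLp_fockKernel_mul hα a z)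

/-- Completing the square: `-|u+z|² + z·conj(u+z) = -|u|² - u·z̄`. Apart from the Gaussian density,
what remains is holomorphic in `u`, so translating by `z` reduces the reproducing property to the
mean value at `0`. -/
theorem fockDensity_mul_fockKernel_add (u z : Fin n → ℂ) :
    (fockDensity n α (u + z) : ℂ) * fockKernel α z (u + z) =
      fockDensity n α u * fockKernel α (-u) z := by
  simp only [fockDensity, fockKernel]
  push_cast
  rw [mul_assoc, mul_assoc, ← Complex.exp_add, ← Complex.exp_add, Finset.mul_sum, Finset.mul_sum,
    Finset.mul_sum, Finset.mul_sum, ← Finset.sum_add_distrib, ← Finset.sum_add_distrib]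
  congr 3
  funext j
  simp only [← Complex.mul_conj', Pi.add_apply, Pi.neg_apply, map_add]
  ring

/-- The reproducing property of the kernel. -/
theorem integral_mul_fockKernel (hα : 0 < α) {G : (Fin n → ℂ) → ℂ} (hG : Differentiable ℂ G)
    (z : Fin n → ℂ) (hi : Integrable (fun w => G w * fockKernel α z w) (fockMeasure n α)) :
    ∫ w, G w * fockKernel α z w ∂fockMeasure n α = G z := by
  have key : ∀ u, fockDensity n α (u + z) • (G (u + z) * fockKernel α z (u + z)) =
      fockDensity n α u • (G (u + z) * fockKernel α (-u) z) := fun u => by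
    simp only [Complex.real_smul]
    linear_combination G (u + z) * fockDensity_mul_fockKernel_add (α := α) u z
  rw [integrable_fockMeasure_iff hα] at hi
  have hi' := hi.comp_add_right z
  rw [integral_fockMeasure hα, ← integral_add_right_eq_self _ z]
  simp_rw [key] at hi' ⊢
  rw [← integrable_fockMeasure_iff hα] at hi'
  rw [← integral_fockMeasure hα, integral_eq_apply_zero hα _ hi']
  · simp [fockKernel_zero_left]
  · exact (hG.comp (differentiable_id.add_const z)).mul
      ((differentiable_fockKernel z).comp differentiable_id.neg)

end kernel

/-! ### Toeplitz operators on kernel functions. -/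

section toeplitz

variable {n : ℕ} {α : ℝ}

theorem toeplitz_fockKernel (hα : 0 < α) {f : (Fin n → ℂ) → ℂ} (hf : MemFock α f)
    (a z : Fin n → ℂ) :
    toeplitz α f (fun w => fockKernel α w a) z = f z * fockKernel α z a :=
  integral_mul_fockKernel hα (hf.1.mul (differentiable_fockKernel a)) z
    (integrable_mul_fockKernel_mul hα hf.2 a z)

theorem MemFock.memLp_conj {g : (Fin n → ℂ) → ℂ} (hg : MemFock α g) :
    MemLp (fun w => starRingEnd ℂ (g w)) 2 (fockMeasure n α) :=
  (memLp_congr_norm hg.2.aestronglyMeasurable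
    (Complex.continuous_conj.comp hg.1.continuous).aestronglyMeasurable
    (Filter.Eventually.of_forall fun w => (RCLike.norm_conj (g w)).symm)).1 hg.2

/-- The integrand is the conjugate of `g K_z` against the kernel at `a`, so the reproducing property
applies at `a` instead of `z`. -/
theorem toeplitz_conj_fockKernel (hα : 0 < α) {g : (Fin n → ℂ) → ℂ} (hg : MemFock α g)
    (a z : Fin n → ℂ) :
    toeplitz α (fun w => starRingEnd ℂ (g w)) (fun w => fockKernel α w a) z =
      starRingEnd ℂ (g a) * fockKernel α z a := by
  have h : ∀ w, starRingEnd ℂ (g w) * fockKernel α w a * fockKernel α z w =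
      starRingEnd ℂ (g w * fockKernel α w z * fockKernel α a w) := fun w => by
    simp only [map_mul, conj_fockKernel]
    ring
  simp_rw [toeplitz, h]
  have := integral_mul_fockKernel hα (hg.1.mul (differentiable_fockKernel z)) a
    (integrable_mul_fockKernel_mul hα hg.2 z a)
  simp only [Pi.mul_apply] at this
  rw [integral_conj, this, map_mul, conj_fockKernel]

theorem fockKernel_mem_kernelSpan (a : Fin n → ℂ) :
    (fun z => fockKernel α z a) ∈ kernelSpan n α :=
  Submodule.subset_span ⟨a, rfl⟩

theorem integrable_mul_of_mem_kernelSpan (hα : 0 < α) {φ h : (Fin n → ℂ) → ℂ}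
    (hφ : MemLp φ 2 (fockMeasure n α)) (hh : h ∈ kernelSpan n α) (z : Fin n → ℂ) :
    Integrable (fun w => φ w * h w * fockKernel α z w) (fockMeasure n α) := by
  induction hh using Submodule.span_induction with
  | mem x hx =>
    obtain ⟨a, rfl⟩ := hx
    exact integrable_mul_fockKernel_mul hα hφ a z
  | zero => simp
  | add x y _ _ hx hy =>
    simp only [Pi.add_apply, mul_add, add_mul]
    exact hx.add hy
  | smul c x _ hx => simpa [mul_left_comm, mul_assoc] using hx.const_mul c

theorem toeplitz_add (hα : 0 < α) {φ h k : (Fin n → ℂ) → ℂ} (hφ : MemLp φ 2 (fockMeasure n α))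
    (hh : h ∈ kernelSpan n α) (hk : k ∈ kernelSpan n α) :
    toeplitz α φ (h + k) = toeplitz α φ h + toeplitz α φ k := by
  funext z
  rw [Pi.add_apply, toeplitz, toeplitz, toeplitz, ← integral_add
    (integrable_mul_of_mem_kernelSpan hα hφ hh z) (integrable_mul_of_mem_kernelSpan hα hφ hk z)]
  simp [mul_add, add_mul]

theorem toeplitz_smul (φ h : (Fin n → ℂ) → ℂ) (c : ℂ) :
    toeplitz α φ (c • h) = c • toeplitz α φ h := by
  funext z
  simp [toeplitz, ← integral_const_mul, mul_left_comm, mul_assoc]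

theorem toeplitz_zero_right (φ : (Fin n → ℂ) → ℂ) : toeplitz α φ 0 = 0 := by
  funext z
  simp [toeplitz]

theorem toeplitz_conj_mem_kernelSpan (hα : 0 < α) {g h : (Fin n → ℂ) → ℂ} (hg : MemFock α g)
    (hh : h ∈ kernelSpan n α) :
    toeplitz α (fun w => starRingEnd ℂ (g w)) h ∈ kernelSpan n α := by
  induction hh using Submodule.span_induction with
  | mem x hx =>
    obtain ⟨a, rfl⟩ := hx
    have : toeplitz α (fun w => starRingEnd ℂ (g w)) (fun w => fockKernel α w a) =
        starRingEnd ℂ (g a) • fun z => fockKernel α z a :=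
      funext fun z => toeplitz_conj_fockKernel hα hg a z
    rw [this]
    exact Submodule.smul_mem _ _ (fockKernel_mem_kernelSpan a)
  | zero => rw [toeplitz_zero_right]; exact Submodule.zero_mem _
  | add x y hx' hy' hx hy =>
    rw [toeplitz_add hα hg.memLp_conj hx' hy']
    exact Submodule.add_mem _ hx hy
  | smul c x _ hx =>
    rw [toeplitz_smul]
    exact Submodule.smul_mem _ _ hx

theorem toeplitzProduct_fockKernel (hα : 0 < α) {f g : (Fin n → ℂ) → ℂ} (hf : MemFock α f)
    (hg : MemFock α g) (a : Fin n → ℂ) :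
    toeplitzProduct α f g (fun z => fockKernel α z a) =
      fun z => starRingEnd ℂ (g a) * (f z * fockKernel α z a) := by
  have : toeplitz α (fun w => starRingEnd ℂ (g w)) (fun w => fockKernel α w a) =
      starRingEnd ℂ (g a) • fun z => fockKernel α z a :=
    funext fun z => toeplitz_conj_fockKernel hα hg a z
  funext z
  rw [toeplitzProduct, this, toeplitz_smul, Pi.smul_apply, toeplitz_fockKernel hα hf, smul_eq_mul]

theorem toeplitzProduct_add (hα : 0 < α) {f g h k : (Fin n → ℂ) → ℂ} (hf : MemFock α f)
    (hg : MemFock α g) (hh : h ∈ kernelSpan n α) (hk : k ∈ kernelSpan n α) :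
    toeplitzProduct α f g (h + k) = toeplitzProduct α f g h + toeplitzProduct α f g k := by
  rw [toeplitzProduct, toeplitz_add hα hg.memLp_conj hh hk, toeplitz_add hα hf.2
    (toeplitz_conj_mem_kernelSpan hα hg hh) (toeplitz_conj_mem_kernelSpan hα hg hk)]
  rfl

theorem toeplitzProduct_smul (f g h : (Fin n → ℂ) → ℂ) (c : ℂ) :
    toeplitzProduct α f g (c • h) = c • toeplitzProduct α f g h := by
  rw [toeplitzProduct, toeplitz_smul, toeplitz_smul]
  rfl

theorem toeplitzProduct_zero (f g : (Fin n → ℂ) → ℂ) : toeplitzProduct α f g 0 = 0 := by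
  rw [toeplitzProduct, toeplitz_zero_right, toeplitz_zero_right]

end toeplitz

/-! ### Point evaluations, density of the kernels, uniqueness of the extension. -/

section FockSpace

variable {n : ℕ} {α : ℝ}

/-- The element of the Fock space represented by a function. -/
noncomputable def MemFock.toFock {h : (Fin n → ℂ) → ℂ} (hh : MemFock α h) : FockSpace n α :=
  ⟨hh.2.toLp h, h, hh.1, hh.2.coeFn_toLp⟩

theorem MemFock.coeFn_toFock {h : (Fin n → ℂ) → ℂ} (hh : MemFock α h) :
    (hh.toFock : Lp ℂ 2 (fockMeasure n α)) =ᵐ[fockMeasure n α] h :=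
  hh.2.coeFn_toLp

theorem FockSpace.ext_ae {F G : FockSpace n α}
    (h : (F : Lp ℂ 2 (fockMeasure n α)) =ᵐ[fockMeasure n α] (G : Lp ℂ 2 (fockMeasure n α))) :
    F = G :=
  Subtype.ext (Lp.ext h)

theorem MemFock.eq_toFock {h : (Fin n → ℂ) → ℂ} (hh : MemFock α h) {F : FockSpace n α}
    (hF : (F : Lp ℂ 2 (fockMeasure n α)) =ᵐ[fockMeasure n α] h) : F = hh.toFock :=
  FockSpace.ext_ae (hF.trans hh.coeFn_toFock.symm)

/-- The kernel function `K(·, a)` as an element of the Fock space. -/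
noncomputable def kernelVec (hα : 0 < α) (a : Fin n → ℂ) : FockSpace n α :=
  (memFock_fockKernel hα a).toFock

theorem inner_kernelVec_eq_integral (hα : 0 < α) (a : Fin n → ℂ)
    (F : Lp ℂ 2 (fockMeasure n α)) :
    inner ℂ (kernelVec hα a : Lp ℂ 2 (fockMeasure n α)) F =
      ∫ w, F w * fockKernel α a w ∂fockMeasure n α := by
  rw [L2.inner_def]
  refine integral_congr_ae ?_
  filter_upwards [(memFock_fockKernel hα a).coeFn_toFock] with w hw
  rw [kernelVec, hw, RCLike.inner_apply, conj_fockKernel]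

theorem inner_kernelVec (hα : 0 < α) (a : Fin n → ℂ) {F : Lp ℂ 2 (fockMeasure n α)}
    {h : (Fin n → ℂ) → ℂ} (hd : Differentiable ℂ h) (hF : F =ᵐ[fockMeasure n α] h) :
    inner ℂ (kernelVec hα a : Lp ℂ 2 (fockMeasure n α)) F = h a := by
  have hh : MemLp h 2 (fockMeasure n α) := (memLp_congr_ae hF).1 (Lp.memLp F)
  rw [inner_kernelVec_eq_integral]
  -- Integrability comes from the product of two kernels with the first one, `K(w, 0)`, equal to
  -- `1`.
  have := integral_mul_fockKernel hα hd a (by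
    simpa [fockKernel_zero_right] using integrable_mul_fockKernel_mul hα hh 0 a)
  rw [← this]
  refine integral_congr_ae ?_
  filter_upwards [hF] with w hw
  rw [hw]

theorem norm_kernelVec (hα : 0 < α) (a : Fin n → ℂ) :
    ‖kernelVec hα a‖ = Real.exp (α / 2 * ∑ j, ‖a j‖ ^ 2) := by
  have h := inner_kernelVec hα a (differentiable_fockKernel a)
    (memFock_fockKernel hα a).coeFn_toFock
  change inner ℂ (kernelVec hα a : Lp ℂ 2 (fockMeasure n α)) (kernelVec hα a : Lp ℂ 2 _) = _ at h
  rw [inner_self_eq_norm_sq_to_K, fockKernel_self] at h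
  have h2 : ‖kernelVec hα a‖ ^ 2 = Real.exp (α / 2 * ∑ j, ‖a j‖ ^ 2) ^ 2 := by
    rw [← Real.exp_nat_mul]
    have : ‖kernelVec hα a‖ ^ 2 = Real.exp (α * ∑ j, ‖a j‖ ^ 2) := by
      apply Complex.ofReal_injective
      rw [← h]
      push_cast
      rfl
    rw [this]
    congr 1
    push_cast; ring
  exact (sq_eq_sq₀ (norm_nonneg _) (Real.exp_pos _).le).1 h2

/-- Point evaluations are bounded on the Fock space. -/
theorem norm_apply_le (hα : 0 < α) (a : Fin n → ℂ) {F : FockSpace n α}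
    {h : (Fin n → ℂ) → ℂ} (hd : Differentiable ℂ h)
    (hF : (F : Lp ℂ 2 (fockMeasure n α)) =ᵐ[fockMeasure n α] h) :
    ‖h a‖ ≤ Real.exp (α / 2 * ∑ j, ‖a j‖ ^ 2) * ‖F‖ := by
  rw [← inner_kernelVec hα a hd hF, ← norm_kernelVec hα a]
  exact norm_inner_le_norm _ _

/-- The kernel functions span a dense subspace of the Fock space. -/
theorem coe_mem_topologicalClosure_span_kernelVec (hα : 0 < α) (F : FockSpace n α) :
    (F : Lp ℂ 2 (fockMeasure n α)) ∈ (Submodule.span ℂ (Set.range fun a : Fin n → ℂ =>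
      (kernelVec hα a : Lp ℂ 2 (fockMeasure n α)))).topologicalClosure := by
  set V := Submodule.span ℂ (Set.range fun a : Fin n → ℂ =>
    (kernelVec hα a : Lp ℂ 2 (fockMeasure n α))) with hV
  have hVF : V ≤ FockSpace n α := by
    rw [hV, Submodule.span_le]
    rintro _ ⟨a, rfl⟩
    exact (kernelVec hα a).2
  -- The projection is taken in the complete space `L²`, so closedness of the Fock space is not
  -- needed; in return, `y` is not known in advance to be entire.
  obtain ⟨y, hy, r, hr, hyr⟩ := Submodule.exists_add_mem_mem_orthogonal
    (K := V.topologicalClosure) (F : Lp ℂ 2 (fockMeasure n α))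
  obtain ⟨h, hd, hF⟩ := F.2
  have hinner : ∀ a, inner ℂ (kernelVec hα a : Lp ℂ 2 (fockMeasure n α)) y = h a := by
    intro a
    have h0 : inner ℂ (kernelVec hα a : Lp ℂ 2 (fockMeasure n α)) r = 0 :=
      hr _ (V.le_topologicalClosure (Submodule.subset_span ⟨a, rfl⟩))
    rw [← inner_kernelVec hα a hd hF, hyr, inner_add_right, h0, add_zero]
  -- Approximants `x i` in the span satisfy `x i a = ⟨K_a, x i⟩` almost everywhere, and the right
  -- side tends to `⟨K_a, y⟩ = h a`. A subsequence also tends to `y` almost everywhere.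
  have hy' : y =ᵐ[fockMeasure n α] h := by
    obtain ⟨x, hxV, hx⟩ := mem_closure_iff_seq_limit.1 hy
    obtain ⟨ns, hmono, hns⟩ := (tendstoInMeasure_of_tendsto_Lp hx).exists_seq_tendsto_ae
    have hns' : ∀ᵐ a ∂fockMeasure n α, ∀ i, x i a =
        inner ℂ (kernelVec hα a : Lp ℂ 2 (fockMeasure n α)) (x i) := by
      rw [ae_all_iff]
      intro i
      obtain ⟨k, hk, hxk⟩ := hVF (hxV i)
      filter_upwards [hxk] with a ha
      rw [ha, inner_kernelVec hα a hk hxk]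
    filter_upwards [hns, hns'] with a h1 h2
    have h3 := (((continuous_const (y := (kernelVec hα a : Lp ℂ 2 (fockMeasure n α)))).inner
      (𝕜 := ℂ) continuous_id).tendsto y).comp hx
    rw [← hinner a]
    refine tendsto_nhds_unique h1 ((h3.comp hmono.tendsto_atTop).congr fun i => ?_)
    simp [h2]
  have : (F : Lp ℂ 2 (fockMeasure n α)) = y := Lp.ext (hF.trans hy'.symm)
  rw [this]
  exact hy

/-- A bounded operator on the Fock space is determined by its values on the kernel functions. -/
theorem ContinuousLinearMap.ext_kernelVec (hα : 0 < α) {S T : FockSpace n α →L[ℂ] FockSpace n α}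
    (h : ∀ a, S (kernelVec hα a) = T (kernelVec hα a)) : S = T := by
  have hs : Dense (Submodule.span ℂ (Set.range (kernelVec (n := n) hα)) :
      Set (FockSpace n α)) := by
    intro F
    rw [closure_subtype]
    have hF := coe_mem_topologicalClosure_span_kernelVec hα F
    rw [← SetLike.mem_coe, Submodule.topologicalClosure_coe] at hF
    have := Submodule.map_span (FockSpace n α).subtype (Set.range (kernelVec (n := n) hα))
    rw [← Set.range_comp] at this
    rw [← Submodule.coe_subtype, ← Submodule.map_coe, this]
    exact hF
  exact ContinuousLinearMap.ext_on hs (by rintro _ ⟨a, rfl⟩; exact h a)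

theorem ExtendsToeplitzProduct.apply_kernelVec (hα : 0 < α) {f g : (Fin n → ℂ) → ℂ}
    (hf : MemFock α f) (hg : MemFock α g) {T : FockSpace n α →L[ℂ] FockSpace n α}
    (hT : ExtendsToeplitzProduct α f g T) (a : Fin n → ℂ) :
    (T (kernelVec hα a) : Lp ℂ 2 (fockMeasure n α)) =ᵐ[fockMeasure n α]
      fun z => starRingEnd ℂ (g a) * (f z * fockKernel α z a) := by
  obtain ⟨H, hH, hTH⟩ := hT _ (fockKernel_mem_kernelSpan a)
  rw [toeplitzProduct_fockKernel hα hf hg] at hTH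
  rwa [kernelVec, ← (memFock_fockKernel hα a).eq_toFock hH]

theorem ExtendsToeplitzProduct.unique (hα : 0 < α) {f g : (Fin n → ℂ) → ℂ}
    (hf : MemFock α f) (hg : MemFock α g) {S T : FockSpace n α →L[ℂ] FockSpace n α}
    (hS : ExtendsToeplitzProduct α f g S) (hT : ExtendsToeplitzProduct α f g T) : S = T :=
  ContinuousLinearMap.ext_kernelVec hα fun a => FockSpace.ext_ae <|
    (hS.apply_kernelVec hα hf hg a).trans (hT.apply_kernelVec hα hf hg a).symm

theorem ExtendsToeplitzProduct.of_apply_kernelVec (hα : 0 < α) {f g : (Fin n → ℂ) → ℂ}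
    (hf : MemFock α f) (hg : MemFock α g) {T : FockSpace n α →L[ℂ] FockSpace n α}
    (hT : ∀ a, (T (kernelVec hα a) : Lp ℂ 2 (fockMeasure n α)) =ᵐ[fockMeasure n α]
      fun z => starRingEnd ℂ (g a) * (f z * fockKernel α z a)) :
    ExtendsToeplitzProduct α f g T := by
  intro h hh
  induction hh using Submodule.span_induction with
  | mem x hx =>
    obtain ⟨a, rfl⟩ := hx
    refine ⟨kernelVec hα a, (memFock_fockKernel hα a).coeFn_toFock, ?_⟩
    rw [toeplitzProduct_fockKernel hα hf hg]
    exact hT a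
  | zero =>
    refine ⟨0, Lp.coeFn_zero _ _ _, ?_⟩
    rw [toeplitzProduct_zero, map_zero]
    exact Lp.coeFn_zero _ _ _
  | add x y hx' hy' hx hy =>
    obtain ⟨X, hX, hTX⟩ := hx
    obtain ⟨Y, hY, hTY⟩ := hy
    refine ⟨X + Y, (Lp.coeFn_add _ _).trans (hX.add hY), ?_⟩
    rw [toeplitzProduct_add hα hf hg hx' hy', map_add]
    exact (Lp.coeFn_add _ _).trans (hTX.add hTY)
  | smul c x _ hx =>
    obtain ⟨X, hX, hTX⟩ := hx
    refine ⟨c • X, (Lp.coeFn_smul _ _).trans (hX.const_smul c), ?_⟩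
    rw [toeplitzProduct_smul, map_smul]
    exact (Lp.coeFn_smul _ _).trans (hTX.const_smul c)

end FockSpace

/-! ### Weighted translations as unitary operators. -/

section translation

variable {n : ℕ} {α : ℝ}

theorem FockSpace.exists_memFock (F : FockSpace n α) : ∃ h : (Fin n → ℂ) → ℂ,
    MemFock α h ∧ (F : Lp ℂ 2 (fockMeasure n α)) =ᵐ[fockMeasure n α] h := by
  obtain ⟨h, hd, hF⟩ := F.2
  exact ⟨h, ⟨hd, (memLp_congr_ae hF).1 (Lp.memLp _)⟩, hF⟩

/-- The entire function representing an element of the Fock space. -/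
noncomputable def FockSpace.rep (F : FockSpace n α) : (Fin n → ℂ) → ℂ :=
  (FockSpace.exists_memFock F).choose

theorem FockSpace.memFock_rep (F : FockSpace n α) : MemFock α (FockSpace.rep F) :=
  (FockSpace.exists_memFock F).choose_spec.1

theorem FockSpace.coeFn_ae_eq_rep (F : FockSpace n α) :
    (F : Lp ℂ 2 (fockMeasure n α)) =ᵐ[fockMeasure n α] (FockSpace.rep F) :=
  (FockSpace.exists_memFock F).choose_spec.2

theorem FockSpace.rep_eq (hα : 0 < α) {F : FockSpace n α} {h : (Fin n → ℂ) → ℂ}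
    (hd : Differentiable ℂ h)
    (hF : (F : Lp ℂ 2 (fockMeasure n α)) =ᵐ[fockMeasure n α] h) : (FockSpace.rep F) = h :=
  eq_of_ae_eq_fockMeasure hα (FockSpace.memFock_rep F).1.continuous hd.continuous
    ((FockSpace.coeFn_ae_eq_rep F).symm.trans hF)

/-- The weighted translation `h ↦ h(· - a) k_a` on functions. -/
noncomputable def weightedTranslate (α : ℝ) (a : Fin n → ℂ) (h : (Fin n → ℂ) → ℂ) :
    (Fin n → ℂ) → ℂ :=
  fun z => h (z - a) * normalizedKernel α a z

theorem normalizedKernel_eq (a z : Fin n → ℂ) : normalizedKernel α a z =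
    fockKernel α z a * Real.exp (-(α / 2 * ∑ j, ‖a j‖ ^ 2)) := by
  rw [normalizedKernel, fockKernel, Complex.ofReal_exp, ← Complex.exp_add]
  push_cast
  ring_nf

theorem differentiable_normalizedKernel (a : Fin n → ℂ) :
    Differentiable ℂ (normalizedKernel α a) := by
  rw [show normalizedKernel α a = _ from funext (normalizedKernel_eq a)]
  exact (differentiable_fockKernel a).mul_const _

/-- The cocycle identity behind `U_{-a} U_a = 1`, hence behind surjectivity. -/
theorem normalizedKernel_mul_neg (a z : Fin n → ℂ) :
    normalizedKernel α a (z + a) * normalizedKernel α (-a) z = 1 := by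
  have h1 : fockKernel α z (-a) * fockKernel α z a = 1 := by
    rw [← fockKernel_add_right, neg_add_cancel, fockKernel_zero_right]
  have h2 : (Real.exp (-(α / 2 * ∑ j, ‖a j‖ ^ 2)) : ℂ) *
      Real.exp (-(α / 2 * ∑ j, ‖a j‖ ^ 2)) * Real.exp (α * ∑ j, ‖a j‖ ^ 2) = 1 := by
    rw [← Complex.ofReal_mul, ← Complex.ofReal_mul, ← Real.exp_add, ← Real.exp_add,
      ← Complex.ofReal_one, ← Real.exp_zero]
    congr 2
    ring
  simp only [normalizedKernel_eq, fockKernel_add_left, fockKernel_self, Pi.neg_apply, norm_neg]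
  linear_combination (Real.exp (-(α / 2 * ∑ j, ‖a j‖ ^ 2)) : ℂ) *
    Real.exp (-(α / 2 * ∑ j, ‖a j‖ ^ 2)) * Real.exp (α * ∑ j, ‖a j‖ ^ 2) * h1 + h2

theorem weightedTranslate_neg (a : Fin n → ℂ) (h : (Fin n → ℂ) → ℂ) :
    weightedTranslate α (-a) (weightedTranslate α a h) = h := by
  funext z
  simp [weightedTranslate, mul_assoc, normalizedKernel_mul_neg]

/-- The weight `|k_a|²` is exactly the Jacobian of the Gaussian measure under translation; this
makes `U_a` isometric. -/
theorem fockDensity_add_mul (a z : Fin n → ℂ) :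
    fockDensity n α (z + a) * ‖normalizedKernel α a (z + a)‖ ^ 2 = fockDensity n α z := by
  rw [normalizedKernel_eq, norm_mul, norm_fockKernel, Complex.norm_real, Real.norm_eq_abs,
    Real.abs_exp, ← Real.exp_add, ← Real.exp_nat_mul, fockDensity, fockDensity, mul_assoc,
    ← Real.exp_add]
  congr 2
  simp only [Nat.cast_ofNat, mul_add, Finset.mul_sum, ← Finset.sum_neg_distrib,
    ← Finset.sum_add_distrib]
  refine Finset.sum_congr rfl fun j _ => ?_
  simp only [Pi.add_apply, ← Complex.normSq_eq_norm_sq, Complex.normSq_apply, Complex.mul_re,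
    Complex.add_re, Complex.add_im, Complex.conj_re, Complex.conj_im]
  ring

theorem lintegral_weightedTranslate (a : Fin n → ℂ) (h : (Fin n → ℂ) → ℂ) :
    ∫⁻ z, ‖weightedTranslate α a h z‖ₑ ^ 2 ∂fockMeasure n α =
      ∫⁻ z, ‖h z‖ₑ ^ 2 ∂fockMeasure n α := by
  rw [fockMeasure_eq, lintegral_withDensity_eq_lintegral_mul_non_measurable _
    (measurable_ofReal_fockDensity n α) (by simp),
    lintegral_withDensity_eq_lintegral_mul_non_measurable _
    (measurable_ofReal_fockDensity n α) (by simp), ← lintegral_add_right_eq_self _ a]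
  refine lintegral_congr fun z => ?_
  rw [Pi.mul_apply, Pi.mul_apply, ← fockDensity_add_mul a z, ENNReal.ofReal_mul' (by positivity),
    weightedTranslate, add_sub_cancel_right, enorm_mul, mul_pow,
    ← ofReal_norm (normalizedKernel α a _),
    ENNReal.ofReal_pow (norm_nonneg _)]
  ring

theorem eLpNorm_weightedTranslate (a : Fin n → ℂ) (h : (Fin n → ℂ) → ℂ) :
    eLpNorm (weightedTranslate α a h) 2 (fockMeasure n α) = eLpNorm h 2 (fockMeasure n α) := by
  have := lintegral_weightedTranslate (α := α) a h
  simp only [eLpNorm_eq_lintegral_rpow_enorm_toReal two_ne_zero ENNReal.ofNat_ne_top,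
    ENNReal.toReal_ofNat, ENNReal.rpow_ofNat, this]

theorem MemFock.weightedTranslate {h : (Fin n → ℂ) → ℂ} (hh : MemFock α h) (a : Fin n → ℂ) :
    MemFock α (weightedTranslate α a h) := by
  have hd : Differentiable ℂ (_root_.weightedTranslate α a h) :=
    (hh.1.comp (differentiable_id.sub_const a)).mul (differentiable_normalizedKernel a)
  refine ⟨hd, hd.continuous.aestronglyMeasurable, ?_⟩
  rw [eLpNorm_weightedTranslate]
  exact hh.2.2

theorem MemFock.norm_toFock {h : (Fin n → ℂ) → ℂ} (hh : MemFock α h) :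
    ‖hh.toFock‖ = (eLpNorm h 2 (fockMeasure n α)).toReal :=
  Lp.norm_toLp h hh.2

theorem FockSpace.toFock_rep (F : FockSpace n α) : (FockSpace.memFock_rep F).toFock = F :=
  ((FockSpace.memFock_rep F).eq_toFock (FockSpace.coeFn_ae_eq_rep F)).symm

theorem FockSpace.rep_toFock (hα : 0 < α) {h : (Fin n → ℂ) → ℂ} (hh : MemFock α h) :
    FockSpace.rep hh.toFock = h :=
  rep_eq hα hh.1 hh.coeFn_toFock

theorem FockSpace.rep_add (hα : 0 < α) (F G : FockSpace n α) : (FockSpace.rep (F + G)) = (FockSpace.rep F) + (FockSpace.rep G) :=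
  rep_eq hα ((FockSpace.memFock_rep F).1.add (FockSpace.memFock_rep G).1)
    ((Lp.coeFn_add _ _).trans ((FockSpace.coeFn_ae_eq_rep F).add (FockSpace.coeFn_ae_eq_rep G)))

theorem FockSpace.rep_smul (hα : 0 < α) (c : ℂ) (F : FockSpace n α) : (FockSpace.rep (c • F)) = c • (FockSpace.rep F) :=
  rep_eq hα ((FockSpace.memFock_rep F).1.const_smul c)
    ((Lp.coeFn_smul _ _).trans ((FockSpace.coeFn_ae_eq_rep F).const_smul c))

theorem FockSpace.rep_injective : Function.Injective (FockSpace.rep : FockSpace n α → _) :=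
  fun F G h => ext_ae ((FockSpace.coeFn_ae_eq_rep F).trans (h ▸ (FockSpace.coeFn_ae_eq_rep G).symm))

/-- The weighted translation as a linear isometry of the Fock space. -/
noncomputable def weightedTranslation (hα : 0 < α) (a : Fin n → ℂ) :
    FockSpace n α →ₗᵢ[ℂ] FockSpace n α where
  toFun F := ((FockSpace.memFock_rep F).weightedTranslate a).toFock
  map_add' F G := FockSpace.rep_injective <| by
    simp only [FockSpace.rep_toFock hα, FockSpace.rep_add hα]
    funext z
    simp [weightedTranslate, add_mul]
  map_smul' c F := FockSpace.rep_injective <| by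
    simp only [FockSpace.rep_toFock hα, FockSpace.rep_smul hα, RingHom.id_apply]
    funext z
    simp [weightedTranslate, mul_assoc]
  norm_map' F := by
    change ‖((FockSpace.memFock_rep F).weightedTranslate a).toFock‖ = _
    rw [MemFock.norm_toFock, eLpNorm_weightedTranslate, ← (FockSpace.memFock_rep F).norm_toFock,
      (FockSpace.toFock_rep F)]

theorem rep_weightedTranslation (hα : 0 < α) (a : Fin n → ℂ) (F : FockSpace n α) :
    (FockSpace.rep (weightedTranslation hα a F)) = weightedTranslate α a (FockSpace.rep F) :=
  FockSpace.rep_toFock hα ((FockSpace.memFock_rep F).weightedTranslate a)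

/-- The weighted translation as a unitary operator of the Fock space. -/
noncomputable def weightedTranslationEquiv (hα : 0 < α) (a : Fin n → ℂ) :
    FockSpace n α ≃ₗᵢ[ℂ] FockSpace n α :=
  LinearIsometryEquiv.ofSurjective (weightedTranslation hα a) fun F =>
    ⟨weightedTranslation hα (-a) F, FockSpace.rep_injective <| by
      rw [rep_weightedTranslation, rep_weightedTranslation]
      simpa using weightedTranslate_neg (α := α) (-a) (FockSpace.rep F)⟩

theorem rep_weightedTranslationEquiv (hα : 0 < α) (a : Fin n → ℂ) (F : FockSpace n α) :
    (FockSpace.rep (weightedTranslationEquiv hα a F)) = weightedTranslate α a (FockSpace.rep F) :=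
  rep_weightedTranslation hα a F

theorem isWeightedTranslation_weightedTranslationEquiv (hα : 0 < α) (a : Fin n → ℂ) :
    IsWeightedTranslation α a (weightedTranslationEquiv hα a) := by
  intro F
  have h1 := (FockSpace.coeFn_ae_eq_rep (weightedTranslationEquiv hα a F))
  rw [rep_weightedTranslationEquiv] at h1
  -- The Gaussian and Lebesgue measures have the same null sets, and translation preserves the
  -- latter.
  have h2 : ∀ᵐ z ∂fockMeasure n α, (F : Lp ℂ 2 (fockMeasure n α)) (z - a) = (FockSpace.rep F) (z - a) :=
    (ae_fockMeasure_iff hα).2 ((measurePreserving_sub_right volume a).quasiMeasurePreserving.ae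
      ((ae_fockMeasure_iff hα).1 (FockSpace.coeFn_ae_eq_rep F)))
  filter_upwards [h1, h2] with z hz1 hz2
  rw [hz1, hz2, weightedTranslate]

end translation

/-! ### Rigidity of bounded products, and the converse. -/

section main

variable {n : ℕ} {α : ℝ}

theorem exp_mul_exp_eq_mul_norm_fockKernel (z u : Fin n → ℂ) :
    Real.exp (α / 2 * ∑ j, ‖(z + u) j‖ ^ 2) * Real.exp (α / 2 * ∑ j, ‖z j‖ ^ 2) =
      Real.exp (α / 2 * ∑ j, ‖u j‖ ^ 2) * ‖fockKernel α (z + u) z‖ := by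
  rw [norm_fockKernel, ← Real.exp_add, ← Real.exp_add]
  congr 1
  simp only [Finset.mul_sum, ← Finset.sum_add_distrib]
  refine Finset.sum_congr rfl fun j _ => ?_
  simp only [Pi.add_apply, ← Complex.normSq_eq_norm_sq, Complex.normSq_apply, Complex.mul_re,
    Complex.add_re, Complex.add_im, Complex.conj_re, Complex.conj_im]
  ring

/-- The point is that the bound does not depend on `z`: the growth of the point evaluation and of
`‖K_z‖` is matched by `|K(z+u, z)|`, which is then cancelled. -/
theorem ExtendsToeplitzProduct.norm_mul_le (hα : 0 < α) {f g : (Fin n → ℂ) → ℂ}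
    (hf : MemFock α f) (hg : MemFock α g) {T : FockSpace n α →L[ℂ] FockSpace n α}
    (hT : ExtendsToeplitzProduct α f g T) (z u : Fin n → ℂ) :
    ‖f (z + u) * g z‖ ≤ ‖T‖ * Real.exp (α / 2 * ∑ j, ‖u j‖ ^ 2) := by
  have h1 := norm_apply_le hα (z + u)
    ((hf.1.mul (differentiable_fockKernel z)).const_mul (starRingEnd ℂ (g z)))
    (hT.apply_kernelVec hα hf hg z)
  have h2 := T.le_opNorm (kernelVec hα z)
  rw [norm_kernelVec] at h2
  have hK : 0 < ‖fockKernel α (z + u) z‖ := by rw [norm_fockKernel]; exact Real.exp_pos _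
  refine le_of_mul_le_mul_right ?_ hK
  calc ‖f (z + u) * g z‖ * ‖fockKernel α (z + u) z‖
      = ‖starRingEnd ℂ (g z) * (f (z + u) * fockKernel α (z + u) z)‖ := by
        simp only [norm_mul, RCLike.norm_conj]
        ring
    _ ≤ _ := h1
    _ ≤ Real.exp (α / 2 * ∑ j, ‖(z + u) j‖ ^ 2) *
          (‖T‖ * Real.exp (α / 2 * ∑ j, ‖z j‖ ^ 2)) := by gcongr
    _ = ‖T‖ * (Real.exp (α / 2 * ∑ j, ‖(z + u) j‖ ^ 2) *
          Real.exp (α / 2 * ∑ j, ‖z j‖ ^ 2)) := by ring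
    _ = _ := by rw [exp_mul_exp_eq_mul_norm_fockKernel]; ring

/-- For fixed `u` the left side is entire and bounded in `z`, so Liouville's theorem applies. -/
theorem ExtendsToeplitzProduct.apply_add_mul (hα : 0 < α) {f g : (Fin n → ℂ) → ℂ}
    (hf : MemFock α f) (hg : MemFock α g) {T : FockSpace n α →L[ℂ] FockSpace n α}
    (hT : ExtendsToeplitzProduct α f g T) (z u : Fin n → ℂ) :
    f (z + u) * g z = f u * g 0 := by
  have hd : Differentiable ℂ fun z => f (z + u) * g z :=
    (hf.1.comp (differentiable_id.add_const u)).mul hg.1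
  have hb : Bornology.IsBounded (Set.range fun z => f (z + u) * g z) := by
    refine isBounded_iff_forall_norm_le.2 ⟨‖T‖ * Real.exp (α / 2 * ∑ j, ‖u j‖ ^ 2), ?_⟩
    rintro _ ⟨z, rfl⟩
    exact hT.norm_mul_le hα hf hg z u
  simpa using hd.apply_eq_apply_of_bounded hb z 0

/-- An entire function that turns sums into products is the exponential of a linear form. -/
theorem exists_clm_eq_exp_of_map_add {E : Type*} [NormedAddCommGroup E] [NormedSpace ℂ E]
    {F : E → ℂ} (hF : Differentiable ℂ F) (h0 : F 0 = 1) (hadd : ∀ z u, F (z + u) = F z * F u) :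
    ∃ L : E →L[ℂ] ℂ, ∀ z, F z = Complex.exp (L z) := by
  refine ⟨fderiv ℂ F 0, fun z => ?_⟩
  set b := fderiv ℂ F 0 z with hb
  have h0' : HasDerivAt (fun t : ℂ => F (t • z)) b 0 := by
    have h1 : HasFDerivAt F (fderiv ℂ F 0) ((0 : ℂ) • z) := by
      rw [zero_smul]
      exact (hF 0).hasFDerivAt
    have h2 : HasDerivAt (fun t : ℂ => t • z) z 0 := by
      simpa using (hasDerivAt_id (0 : ℂ)).smul_const z
    exact h1.comp_hasDerivAt 0 h2
  -- Factoring `F(s z) = F(t z) F((s - t) z)` carries the derivative at `0` to `t`, giving the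
  -- equation `y' = b y` along the line.
  have hder : ∀ t : ℂ, HasDerivAt (fun t : ℂ => F (t • z)) (F (t • z) * b) t := by
    intro t
    have h1 : HasDerivAt (fun s : ℂ => F (t • z) * F ((s - t) • z)) (F (t • z) * b) t := by
      refine HasDerivAt.const_mul _ ?_
      rw [← sub_self t] at h0'
      exact h0'.comp_sub_const t t
    refine h1.congr_of_eventuallyEq (Filter.Eventually.of_forall fun s => ?_)
    simp only [← hadd, ← add_smul]
    simp
  have hconst : ∀ t : ℂ, HasDerivAt (fun t : ℂ => F (t • z) * Complex.exp (-(t * b))) 0 t := by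
    intro t
    have h1 : HasDerivAt (fun t : ℂ => Complex.exp (-(t * b)))
        (Complex.exp (-(t * b)) * (-b)) t := by
      simpa using ((hasDerivAt_id t).mul_const b).neg.cexp
    refine ((hder t).mul h1).congr_deriv ?_
    ring
  have := is_const_of_deriv_eq_zero (fun t => (hconst t).differentiableAt)
    (fun t => (hconst t).deriv) 1 0
  simp only [one_smul, zero_smul, h0, one_mul, zero_mul, neg_zero, Complex.exp_zero,
    Complex.exp_neg] at this
  exact (mul_inv_eq_one₀ (Complex.exp_ne_zero _)).1 this

theorem ExtendsToeplitzProduct.eq_zero_or_exists (hα : 0 < α) {f g : (Fin n → ℂ) → ℂ}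
    (hf : MemFock α f) (hg : MemFock α g) {T : FockSpace n α →L[ℂ] FockSpace n α}
    (hT : ExtendsToeplitzProduct α f g T) :
    ((∀ z, f z = 0) ∨ (∀ z, g z = 0)) ∨
      ∃ q : MvPolynomial (Fin n) ℂ, q.totalDegree ≤ 1 ∧ ∃ c : ℂ, c ≠ 0 ∧
        (∀ z, f z = Complex.exp (MvPolynomial.eval z q)) ∧
        (∀ z, g z = c * Complex.exp (-MvPolynomial.eval z q)) := by
  have key := hT.apply_add_mul hα hf hg
  by_cases hg0 : g 0 = 0
  -- If `g w ≠ 0`, the choice `u = z - w` gives `f(z) g(w) = 0`.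
  · refine Or.inl (or_iff_not_imp_right.2 fun h z => ?_)
    push Not at h
    obtain ⟨w, hw⟩ := h
    have := key w (z - w)
    simpa [hg0, hw] using this
  by_cases hf0 : f 0 = 0
  · refine Or.inl (Or.inl fun z => ?_)
    have := key (-z) z
    simpa [hf0, hg0] using this
  right
  have hfg : ∀ z, f z * g z = f 0 * g 0 := fun z => by simpa using key z 0
  have hgz : ∀ z, g z ≠ 0 := fun z h => by
    have := hfg z
    simp [h, hf0, hg0] at this
  -- Multiplicativity follows by comparing `f(z+u) g(z) = f(u) g(0)` with `f(z) g(z) = f(0) g(0)`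
  -- and cancelling `g(z)`.
  obtain ⟨L, hL⟩ := exists_clm_eq_exp_of_map_add (F := fun z => f z / f 0)
    (by simpa only [div_eq_mul_inv] using hf.1.mul_const (f 0)⁻¹) (div_self hf0) (fun z u => by
      apply mul_right_cancel₀ (hgz z)
      field_simp
      linear_combination f 0 * key z u - f u * hfg z)
  have hfL : ∀ z, f z = Complex.exp (Complex.log (f 0) + L z) := fun z => by
    rw [Complex.exp_add, Complex.exp_log hf0, ← hL]
    field_simp
  refine ⟨MvPolynomial.C (Complex.log (f 0)) + ∑ j, MvPolynomial.C (L (Pi.single j 1)) *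
    MvPolynomial.X j, ?_, f 0 * g 0, mul_ne_zero hf0 hg0, ?_⟩
  · refine (MvPolynomial.totalDegree_add _ _).trans (max_le (by simp) ?_)
    refine MvPolynomial.totalDegree_finsetSum_le fun j _ => ?_
    refine (MvPolynomial.totalDegree_mul _ _).trans ?_
    simp
  have hq : ∀ z, MvPolynomial.eval z (MvPolynomial.C (Complex.log (f 0)) +
      ∑ j, MvPolynomial.C (L (Pi.single j 1)) * MvPolynomial.X j) = Complex.log (f 0) + L z := by
    intro z
    have : L z = ∑ j, z j * L (Pi.single j 1) := by
      conv_lhs => rw [← Finset.univ_sum_single z, map_sum]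
      refine Finset.sum_congr rfl fun j _ => ?_
      rw [← smul_eq_mul, ← map_smul, ← Pi.single_smul, smul_eq_mul, mul_one]
    simp [this, mul_comm]
  simp_rw [hq]
  refine ⟨hfL, fun z => ?_⟩
  rw [Complex.exp_neg, ← hfL, ← hfg z]
  have : f z ≠ 0 := by rw [hfL]; exact Complex.exp_ne_zero _
  field_simp

/-- A polynomial of degree at most one is affine. -/
theorem exists_eval_eq_of_totalDegree_le_one {σ R : Type*} [Fintype σ] [CommSemiring R]
    {q : MvPolynomial σ R} (hq : q.totalDegree ≤ 1) :
    ∃ (b : R) (β : σ → R), ∀ z, MvPolynomial.eval z q = b + ∑ j, z j * β j := by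
  classical
  refine ⟨q.coeff 0, fun j => q.coeff (Finsupp.single j 1), fun z => ?_⟩
  have hinj : Function.Injective fun j : σ => Finsupp.single j 1 := fun i j h =>
    (Finsupp.single_left_injective one_ne_zero) h
  -- Exponents of degree at most one are `0` and the unit vectors.
  have hsub : q.support ⊆ insert 0 (Finset.univ.image fun j : σ => Finsupp.single j 1) := by
    intro d hd
    have h1 : (d.sum fun _ e => e) ≤ 1 := (MvPolynomial.le_totalDegree hd).trans hq
    have h2 : d.degree ≤ 1 := h1
    rw [Finset.mem_insert]
    rcases Nat.le_one_iff_eq_zero_or_eq_one.1 h2 with h | h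
    · exact Or.inl ((Finsupp.degree_eq_zero_iff d).1 h)
    · obtain ⟨j, hj⟩ := (Finsupp.sum_eq_one_iff d).1 h
      exact Or.inr (Finset.mem_image.2 ⟨j, Finset.mem_univ _, hj.symm⟩)
  rw [MvPolynomial.eval_eq, Finset.sum_subset hsub (by
    intro d _ hd
    rw [MvPolynomial.notMem_support_iff.1 hd, zero_mul]), Finset.sum_insert (by simp),
    Finset.sum_image hinj.injOn]
  congr 1
  · simp
  · refine Finset.sum_congr rfl fun j _ => ?_
    rw [mul_comm, Finset.prod_eq_single j (fun i _ hi => by simp [Ne.symm hi])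
      (fun h => by simp_all)]
    simp

theorem extendsToeplitzProduct_zero (hα : 0 < α) {f g : (Fin n → ℂ) → ℂ} (hf : MemFock α f)
    (hg : MemFock α g) (h : (∀ z, f z = 0) ∨ (∀ z, g z = 0)) :
    ExtendsToeplitzProduct α f g 0 := by
  refine .of_apply_kernelVec hα hf hg fun a => ?_
  have : (fun z => starRingEnd ℂ (g a) * (f z * fockKernel α z a)) = 0 := by
    funext z
    rcases h with h | h <;> simp [h]
  rw [this]
  exact Lp.coeFn_zero _ _ _

theorem exists_extendsToeplitzProduct_smul (hα : 0 < α) {f g : (Fin n → ℂ) → ℂ}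
    (hf : MemFock α f) (hg : MemFock α g)
    (h : ∃ q : MvPolynomial (Fin n) ℂ, q.totalDegree ≤ 1 ∧ ∃ c : ℂ, c ≠ 0 ∧
        (∀ z, f z = Complex.exp (MvPolynomial.eval z q)) ∧
        (∀ z, g z = c * Complex.exp (-MvPolynomial.eval z q))) :
    ∃ c : ℂ, c ≠ 0 ∧ ∃ a : Fin n → ℂ, ExtendsToeplitzProduct α f g
      (c • (weightedTranslationEquiv hα a : FockSpace n α →L[ℂ] FockSpace n α)) := by
  obtain ⟨q, hq, c, hc, hfq, hgq⟩ := h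
  obtain ⟨b, β, hb⟩ := exists_eval_eq_of_totalDegree_le_one hq
  have hα' : (α : ℂ) ≠ 0 := by exact_mod_cast hα.ne'
  obtain ⟨a, ha⟩ : ∃ a : Fin n → ℂ, ∀ z, Complex.exp (∑ j, z j * β j) = fockKernel α z a := by
    -- Chosen so that `α z·ā = ∑ z_j β_j`.
    refine ⟨fun j => starRingEnd ℂ (β j / α), fun z => ?_⟩
    rw [fockKernel, Finset.mul_sum]
    congr 1
    refine Finset.sum_congr rfl fun j _ => ?_
    rw [Complex.conj_conj]
    field_simp
  have hf' : ∀ z, f z = Complex.exp b * fockKernel α z a := fun z => by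
    rw [hfq, hb, Complex.exp_add, ha]
  have hg' : ∀ z, g z = c * (Complex.exp (-b) * (fockKernel α z a)⁻¹) := fun z => by
    rw [hgq, hb, ← ha, ← Complex.exp_neg, ← Complex.exp_add, neg_add]
  -- The first three factors come from the constants in `conj (g w)` and `f`; the last undoes the
  -- normalization in `k_a`.
  refine ⟨starRingEnd ℂ c * starRingEnd ℂ (Complex.exp (-b)) * Complex.exp b *
    Real.exp (α / 2 * ∑ j, ‖a j‖ ^ 2), ?_, a, ?_⟩
  · simp [hc]
  refine .of_apply_kernelVec hα hf hg fun w => ?_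
  have hU := (FockSpace.coeFn_ae_eq_rep (weightedTranslationEquiv hα a (kernelVec hα w)))
  rw [rep_weightedTranslationEquiv, kernelVec, FockSpace.rep_toFock hα] at hU
  refine (Lp.coeFn_smul _ _).trans ((hU.const_smul _).trans (Filter.EventuallyEq.of_eq ?_))
  funext z
  have hE : (Real.exp (α / 2 * ∑ j, ‖a j‖ ^ 2) : ℂ) *
      Real.exp (-(α / 2 * ∑ j, ‖a j‖ ^ 2)) = 1 := by
    rw [← Complex.ofReal_mul, ← Real.exp_add, add_neg_cancel, Real.exp_zero, Complex.ofReal_one]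
  simp only [Pi.smul_apply, smul_eq_mul, weightedTranslate, normalizedKernel_eq, hf', hg',
    sub_eq_add_neg, fockKernel_add_left, fockKernel_neg_left, map_mul, map_inv₀, conj_fockKernel]
  linear_combination (starRingEnd ℂ c * starRingEnd ℂ (Complex.exp (-b)) * Complex.exp b *
    fockKernel α z w * (fockKernel α a w)⁻¹ * fockKernel α z a) * hE

end main

theorem theorem3 (n : ℕ) (α : ℝ) (hα : 0 < α) (f g : (Fin n → ℂ) → ℂ)
    (hf : MemFock α f) (hg : MemFock α g) :
    (BoundedToeplitzProduct α f g ↔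
      ((∀ z, f z = 0) ∨ (∀ z, g z = 0)) ∨
      ∃ q : MvPolynomial (Fin n) ℂ, q.totalDegree ≤ 1 ∧ ∃ c : ℂ, c ≠ 0 ∧
        (∀ z, f z = Complex.exp (MvPolynomial.eval z q)) ∧
        (∀ z, g z = c * Complex.exp (-MvPolynomial.eval z q))) ∧
    (∀ T : FockSpace n α →L[ℂ] FockSpace n α, ExtendsToeplitzProduct α f g T → T ≠ 0 →
      ∃ c : ℂ, c ≠ 0 ∧ ∃ (a : Fin n → ℂ) (U : FockSpace n α ≃ₗᵢ[ℂ] FockSpace n α),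
        IsWeightedTranslation α a U ∧ ∀ H : FockSpace n α, T H = c • U H) := by
  refine ⟨⟨fun ⟨T, hT⟩ => hT.eq_zero_or_exists hα hf hg, ?_⟩, fun T hT hT0 => ?_⟩
  · rintro (h | h)
    · exact ⟨0, extendsToeplitzProduct_zero hα hf hg h⟩
    · obtain ⟨c, -, a, h⟩ := exists_extendsToeplitzProduct_smul hα hf hg h
      exact ⟨_, h⟩
  · rcases hT.eq_zero_or_exists hα hf hg with h | h
    · exact absurd (hT.unique hα hf hg (extendsToeplitzProduct_zero hα hf hg h)) hT0
    · obtain ⟨c, hc, a, h⟩ := exists_extendsToeplitzProduct_smul hα hf hg h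
      refine ⟨c, hc, a, weightedTranslationEquiv hα a,
        isWeightedTranslation_weightedTranslationEquiv hα a, fun H => ?_⟩
      rw [hT.unique hα hf hg h]
      rfl
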